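/- Theorem 1 (the counter-example). Let $F$ be a field of arbitrary characteristic and let $F\langle x,y,z\rangle$ be the free associative $F$-algebra on $x,y,z$. Let $SJ[x,y,z]$ be the free special (quadratic) Jordan algebra, i.e. the smallest subspace of $F\langle x,y,z\rangle$ that contains $x,y,z$ and is closed under the operations $a\mapsto a^2$ and $(a,b)\mapsto U_a b:=aba$; it is then also closed under $a\circ b:=ab+ba$. (In characteristic $\ne 2$ this is the smallest subspace that contains $x,y,z$ and is closed under $\circ$.) An ideal of a quadratic Jordan algebra $A$ is a subspace $I$ such that $i^2,\ a\circ i,\ U_i a,\ U_a i\in I$ for all $i\in I$, $a\in A$; the quotient $A/I$ is again a quadratic Jordan algebra, with the induced operations. Let $I$ be the ideal of $SJ[x,y,z]$ generated by $x\circ y$, and let $J=SJ[x,y,z]/I$. Then the images $\bar x,\bar y$ of $x,y$ in $J$ satisfy $\bar x\circ\bar y=0$, but $U_{\bar x}U_{\bar y}\ne U_{\bar y}U_{\bar x}$ as linear operators on $J$. -/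

import Mathlib

/-- The two products of a (not necessarily unital) quadratic Jordan algebra over `F`: a squaring
`x ↦ x²` and a map `(x, y) ↦ U_x y`, both quadratic in `x`, the latter linear in `y`. -/
class QuadraticJordanData (F : Type*) (J : Type*) [CommRing F] [AddCommGroup J] [Module F J] where
  /-- the squaring `x ↦ x²` -/
  sqMap : QuadraticMap F J J
  /-- the quadratic operators `x ↦ U_x` -/
  UMap : QuadraticMap F J (J →ₗ[F] J)

namespace QuadraticJordan

section Products

variable (F : Type*) {J : Type*} [CommRing F] [AddCommGroup J] [Module F J]
  [QuadraticJordanData F J]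

/-- The square `x²`. -/
def sq (x : J) : J := QuadraticJordanData.sqMap (F := F) x

/-- The operator `U_x`. -/
def U (x : J) : J →ₗ[F] J := QuadraticJordanData.UMap (F := F) x

/-- The circle product `x ∘ y = (x + y)² - x² - y²`. -/
def circ (x y : J) : J := sq F (x + y) - sq F x - sq F y

/-- The linearized operator `U_{x,z} = U_{x+z} - U_x - U_z`; thus `{x y z} = U_{x,z} y`. -/
def U₂ (x z : J) : J →ₗ[F] J := U F (x + z) - U F x - U F z

end Products

end QuadraticJordan

open QuadraticJordan in
/-- A (not necessarily unital) quadratic Jordan algebra over `F`. The defining identities are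
  `V_{x,x} = V_{x²}`, `U_x V_x = V_x U_x`, `U_x x² = (x²)²`, `U_x U_y x² = (U_x y)²`,
  `U_{x²} = U_x U_x`, `U_{U_x y} = U_x U_y U_x`,
where `V_x y = x ∘ y` and `V_{x,y} z = {x y z}`, and they are required to hold strictly (in all
scalar extensions). For an identity of degree 3 or 4 in `x`, strictness amounts to its
linearizations, i.e. the coefficients of `t` (and of `t²` in degree 4) after `x ↦ x + t z`; these
are the axioms with names ending in `_lin` and `_lin₂`. For identities of degree at most 2 in a
variable nothing has to be added. -/
class QuadraticJordanAlgebra (F : Type*) (J : Type*) [CommRing F] [AddCommGroup J] [Module F J]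
    extends QuadraticJordanData F J where
  V_self (x y : J) : U₂ F x y x = circ F (sq F x) y
  U_V (x w : J) : U F x (circ F x w) = circ F x (U F x w)
  U_V_lin (x z w : J) : U₂ F x z (circ F x w) + U F x (circ F z w) =
    circ F z (U F x w) + circ F x (U₂ F x z w)
  U_sq (x : J) : U F x (sq F x) = sq F (sq F x)
  U_sq_lin (x z : J) : U₂ F x z (sq F x) + U F x (circ F x z) = circ F (sq F x) (circ F x z)
  U_sq_lin₂ (x z : J) : U F z (sq F x) + U₂ F x z (circ F x z) + U F x (sq F z) =
    circ F (sq F x) (sq F z) + sq F (circ F x z)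
  sq_U (x y : J) : U F x (U F y (sq F x)) = sq F (U F x y)
  sq_U_lin (x z y : J) : U₂ F x z (U F y (sq F x)) + U F x (U F y (circ F x z)) =
    circ F (U F x y) (U₂ F x z y)
  sq_U_lin₂ (x z y : J) :
    U F z (U F y (sq F x)) + U₂ F x z (U F y (circ F x z)) + U F x (U F y (sq F z)) =
      circ F (U F x y) (U F z y) + sq F (U₂ F x z y)
  U_of_sq (x w : J) : U F (sq F x) w = U F x (U F x w)
  U_of_sq_lin (x z w : J) : U₂ F (sq F x) (circ F x z) w =
    U F x (U₂ F x z w) + U₂ F x z (U F x w)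
  U_of_sq_lin₂ (x z w : J) : U F (circ F x z) w + U₂ F (sq F x) (sq F z) w =
    U F x (U F z w) + U F z (U F x w) + U₂ F x z (U₂ F x z w)
  U_of_U (x y w : J) : U F (U F x y) w = U F x (U F y (U F x w))
  U_of_U_lin (x z y w : J) : U₂ F (U F x y) (U₂ F x z y) w =
    U₂ F x z (U F y (U F x w)) + U F x (U F y (U₂ F x z w))
  U_of_U_lin₂ (x z y w : J) : U F (U₂ F x z y) w + U₂ F (U F x y) (U F z y) w =
    U F z (U F y (U F x w)) + U F x (U F y (U F z w)) + U₂ F x z (U F y (U₂ F x z w))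

namespace QuadraticJordan

/-! ### Elementary rules and transfer of the axioms along homomorphisms -/

section Rules

variable {F : Type*} {J : Type*} [CommRing F] [AddCommGroup J] [Module F J]
  [QuadraticJordanData F J]

theorem sq_smul (a : F) (x : J) : sq F (a • x) = (a * a) • sq F x :=
  QuadraticMap.map_smul _ _ _

theorem U_smul (a : F) (x : J) : U F (a • x) = (a * a) • U F x :=
  QuadraticMap.map_smul _ _ _

theorem circ_add_left (x x' y : J) : circ F (x + x') y = circ F x y + circ F x' y :=
  QuadraticMap.polar_add_left (QuadraticJordanData.sqMap (F := F) (J := J)) x x' y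

theorem circ_smul_left (a : F) (x y : J) : circ F (a • x) y = a • circ F x y :=
  QuadraticMap.polar_smul_left (QuadraticJordanData.sqMap (F := F) (J := J)) a x y

theorem circ_comm (x y : J) : circ F x y = circ F y x :=
  QuadraticMap.polar_comm (QuadraticJordanData.sqMap (F := F) (J := J)) x y

theorem U₂_add_left (x x' y : J) : U₂ F (x + x') y = U₂ F x y + U₂ F x' y :=
  QuadraticMap.polar_add_left (QuadraticJordanData.UMap (F := F) (J := J)) x x' y

theorem U₂_smul_left (a : F) (x y : J) : U₂ F (a • x) y = a • U₂ F x y :=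
  QuadraticMap.polar_smul_left (QuadraticJordanData.UMap (F := F) (J := J)) a x y

theorem sq_add (x y : J) : sq F (x + y) = sq F x + sq F y + circ F x y := by
  simp only [circ]; abel

theorem U_add (x y : J) : U F (x + y) = U F x + U F y + U₂ F x y := by
  simp only [U₂]; abel

end Rules

section Transfer

variable {F : Type*} {J K : Type*} [CommRing F] [AddCommGroup J] [Module F J]
  [AddCommGroup K] [Module F K] [QuadraticJordanData F J] [QuadraticJordanData F K]
  (φ : J →ₗ[F] K)

theorem map_circ (hsq : ∀ x, φ (sq F x) = sq F (φ x)) (x y : J) :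
    φ (circ F x y) = circ F (φ x) (φ y) := by
  simp [circ, hsq]

theorem map_U₂ (hU : ∀ x y, φ (U F x y) = U F (φ x) (φ y)) (x z y : J) :
    φ (U₂ F x z y) = U₂ F (φ x) (φ z) (φ y) := by
  simp [U₂, hU]

end Transfer

/-! ### The algebra `A⁺` of an associative algebra `A` -/

section Plus

set_option linter.unusedSimpArgs false

open SymAlg

variable (F : Type*) (A : Type*) [CommRing F] [Ring A] [Algebra F A]

/-- The products `a² = aa` and `U_a b = aba` on `A⁺`. -/
instance plusData : QuadraticJordanData F Aˢʸᵐ where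
  sqMap := QuadraticMap.ofPolar (fun a => sym (unsym a * unsym a))
    (fun c a => by
      apply unsym_injective
      simp [unsym_smul, mul_smul])
    (fun a a' b => by
      apply unsym_injective
      simp only [QuadraticMap.polar, unsym_add, unsym_sub, unsym_sym]
      noncomm_ring)
    (fun c a b => by
      apply unsym_injective
      simp only [QuadraticMap.polar, unsym_add, unsym_sub, unsym_sym, unsym_smul, add_mul, mul_add,
        smul_mul_assoc, mul_smul_comm, smul_add, smul_sub]
      abel)
  UMap := QuadraticMap.ofPolar
    (fun a =>
      { toFun := fun b => sym (unsym a * unsym b * unsym a)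
        map_add' := fun b b' => by
          apply unsym_injective
          simp only [unsym_add, unsym_sym]
          noncomm_ring
        map_smul' := fun c b => by
          apply unsym_injective
          simp [unsym_smul] })
    (fun c a => by
      ext b
      apply unsym_injective
      simp [unsym_smul, mul_smul])
    (fun a a' b => by
      ext w
      apply unsym_injective
      simp only [QuadraticMap.polar, LinearMap.sub_apply, LinearMap.add_apply, LinearMap.coe_mk,
        AddHom.coe_mk, unsym_add, unsym_sub, unsym_sym]
      noncomm_ring)
    (fun c a b => by
      ext w
      apply unsym_injective
      simp only [QuadraticMap.polar, LinearMap.sub_apply, LinearMap.smul_apply, LinearMap.coe_mk,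
        AddHom.coe_mk, unsym_add, unsym_sub, unsym_sym, unsym_smul, add_mul, mul_add,
        smul_mul_assoc, mul_smul_comm, smul_add, smul_sub]
      abel)

variable {A}

theorem unsym_sq (a : Aˢʸᵐ) : unsym (sq F a) = unsym a * unsym a := rfl

theorem unsym_U (a b : Aˢʸᵐ) : unsym (U F a b) = unsym a * unsym b * unsym a := rfl

theorem unsym_circ (a b : Aˢʸᵐ) :
    unsym (circ F a b) = unsym a * unsym b + unsym b * unsym a := by
  simp only [circ, unsym_sub, unsym_sq, unsym_add]
  noncomm_ring

theorem unsym_U₂ (a b c : Aˢʸᵐ) :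
    unsym (U₂ F a c b) = unsym a * unsym b * unsym c + unsym c * unsym b * unsym a := by
  simp only [U₂, LinearMap.sub_apply, unsym_sub, unsym_U, unsym_add]
  noncomm_ring

variable (A)

/-- `A⁺` is a quadratic Jordan algebra. -/
instance plus : QuadraticJordanAlgebra F Aˢʸᵐ where
  V_self x y := by
    apply unsym_injective
    simp only [unsym_add, unsym_sq, unsym_U, unsym_circ, unsym_U₂]; noncomm_ring
  U_V x w := by
    apply unsym_injective
    simp only [unsym_add, unsym_sq, unsym_U, unsym_circ, unsym_U₂]; noncomm_ring
  U_V_lin x z w := by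
    apply unsym_injective
    simp only [unsym_add, unsym_sq, unsym_U, unsym_circ, unsym_U₂]; noncomm_ring
  U_sq x := by
    apply unsym_injective
    simp only [unsym_add, unsym_sq, unsym_U, unsym_circ, unsym_U₂]; noncomm_ring
  U_sq_lin x z := by
    apply unsym_injective
    simp only [unsym_add, unsym_sq, unsym_U, unsym_circ, unsym_U₂]; noncomm_ring
  U_sq_lin₂ x z := by
    apply unsym_injective
    simp only [unsym_add, unsym_sq, unsym_U, unsym_circ, unsym_U₂]; noncomm_ring
  sq_U x y := by
    apply unsym_injective
    simp only [unsym_add, unsym_sq, unsym_U, unsym_circ, unsym_U₂]; noncomm_ring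
  sq_U_lin x z y := by
    apply unsym_injective
    simp only [unsym_add, unsym_sq, unsym_U, unsym_circ, unsym_U₂]; noncomm_ring
  sq_U_lin₂ x z y := by
    apply unsym_injective
    simp only [unsym_add, unsym_sq, unsym_U, unsym_circ, unsym_U₂]; noncomm_ring
  U_of_sq x w := by
    apply unsym_injective
    simp only [unsym_add, unsym_sq, unsym_U, unsym_circ, unsym_U₂]; noncomm_ring
  U_of_sq_lin x z w := by
    apply unsym_injective
    simp only [unsym_add, unsym_sq, unsym_U, unsym_circ, unsym_U₂]; noncomm_ring
  U_of_sq_lin₂ x z w := by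
    apply unsym_injective
    simp only [unsym_add, unsym_sq, unsym_U, unsym_circ, unsym_U₂]; noncomm_ring
  U_of_U x y w := by
    apply unsym_injective
    simp only [unsym_add, unsym_sq, unsym_U, unsym_circ, unsym_U₂]; noncomm_ring
  U_of_U_lin x z y w := by
    apply unsym_injective
    simp only [unsym_add, unsym_sq, unsym_U, unsym_circ, unsym_U₂]; noncomm_ring
  U_of_U_lin₂ x z y w := by
    apply unsym_injective
    simp only [unsym_add, unsym_sq, unsym_U, unsym_circ, unsym_U₂]; noncomm_ring

end Plus

/-! ### Subalgebras -/

section Subalgebra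

set_option linter.unusedSimpArgs false

variable (F : Type*) {J : Type*} [CommRing F] [AddCommGroup J] [Module F J]

/-- A Jordan subalgebra is a subspace closed under `x²` and `U_x y`. -/
structure IsSubalgebra [QuadraticJordanData F J] (S : Submodule F J) : Prop where
  sq_mem : ∀ x ∈ S, sq F x ∈ S
  U_mem : ∀ x ∈ S, ∀ y ∈ S, U F x y ∈ S

/-- The Jordan subalgebra generated by a set. -/
def adjoin [QuadraticJordanData F J] (s : Set J) : Submodule F J :=
  sInf {S : Submodule F J | IsSubalgebra F S ∧ s ⊆ S}

theorem subset_adjoin [QuadraticJordanData F J] (s : Set J) : s ⊆ adjoin F s := by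
  intro x hx
  simp only [adjoin, SetLike.mem_coe, Submodule.mem_sInf]
  exact fun S hS => hS.2 hx

theorem isSubalgebra_adjoin [QuadraticJordanData F J] (s : Set J) :
    IsSubalgebra F (adjoin F s) where
  sq_mem x hx := by
    simp only [adjoin, Submodule.mem_sInf] at hx ⊢
    exact fun S hS => hS.1.sq_mem x (hx S hS)
  U_mem x hx y hy := by
    simp only [adjoin, Submodule.mem_sInf] at hx hy ⊢
    exact fun S hS => hS.1.U_mem x (hx S hS) y (hy S hS)

/-- The products of a subalgebra are the restrictions of those of `J`. -/
abbrev subalgebraData [QuadraticJordanData F J] (S : Submodule F J) (hS : IsSubalgebra F S) :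
    QuadraticJordanData F S where
  sqMap := QuadraticMap.ofPolar (fun x => ⟨sq F (x : J), hS.sq_mem _ x.2⟩)
    (fun a x => Subtype.ext (sq_smul a (x : J)))
    (fun x x' y => Subtype.ext (circ_add_left (x : J) x' y))
    (fun a x y => Subtype.ext (circ_smul_left a (x : J) y))
  UMap := QuadraticMap.ofPolar
    (fun x => (U F (x : J)).restrict (fun y hy => hS.U_mem _ x.2 y hy))
    (fun a x => LinearMap.ext fun w => Subtype.ext
      (LinearMap.congr_fun (U_smul a (x : J)) (w : J)))
    (fun x x' y => LinearMap.ext fun w => Subtype.ext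
      (LinearMap.congr_fun (U₂_add_left (x : J) x' y) (w : J)))
    (fun a x y => LinearMap.ext fun w => Subtype.ext
      (LinearMap.congr_fun (U₂_smul_left a (x : J) y) (w : J)))

/-- A subalgebra of a quadratic Jordan algebra is one. -/
abbrev subalgebra [QuadraticJordanAlgebra F J] (S : Submodule F J) (hS : IsSubalgebra F S) :
    QuadraticJordanAlgebra F S :=
  letI := subalgebraData F S hS
  have hs : ∀ x : S, S.subtype (sq F x) = sq F (S.subtype x) := fun _ => rfl
  have hU : ∀ x y : S, S.subtype (U F x y) = U F (S.subtype x) (S.subtype y) := fun _ _ => rfl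
  have hc := map_circ S.subtype hs
  have hU₂ := map_U₂ S.subtype hU
  { V_self := fun x y => by
      apply S.injective_subtype
      simp only [hs, hU, hc, hU₂, map_add, QuadraticJordanAlgebra.V_self]
    U_V := fun x w => by
      apply S.injective_subtype
      simp only [hs, hU, hc, hU₂, map_add, QuadraticJordanAlgebra.U_V]
    U_V_lin := fun x z w => by
      apply S.injective_subtype
      simp only [hs, hU, hc, hU₂, map_add, QuadraticJordanAlgebra.U_V_lin]
    U_sq := fun x => by
      apply S.injective_subtype
      simp only [hs, hU, hc, hU₂, map_add, QuadraticJordanAlgebra.U_sq]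
    U_sq_lin := fun x z => by
      apply S.injective_subtype
      simp only [hs, hU, hc, hU₂, map_add, QuadraticJordanAlgebra.U_sq_lin]
    U_sq_lin₂ := fun x z => by
      apply S.injective_subtype
      simp only [hs, hU, hc, hU₂, map_add, QuadraticJordanAlgebra.U_sq_lin₂]
    sq_U := fun x y => by
      apply S.injective_subtype
      simp only [hs, hU, hc, hU₂, map_add, QuadraticJordanAlgebra.sq_U]
    sq_U_lin := fun x z y => by
      apply S.injective_subtype
      simp only [hs, hU, hc, hU₂, map_add, QuadraticJordanAlgebra.sq_U_lin]
    sq_U_lin₂ := fun x z y => by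
      apply S.injective_subtype
      simp only [hs, hU, hc, hU₂, map_add, QuadraticJordanAlgebra.sq_U_lin₂]
    U_of_sq := fun x w => by
      apply S.injective_subtype
      simp only [hs, hU, hc, hU₂, map_add, QuadraticJordanAlgebra.U_of_sq]
    U_of_sq_lin := fun x z w => by
      apply S.injective_subtype
      simp only [hs, hU, hc, hU₂, map_add, QuadraticJordanAlgebra.U_of_sq_lin]
    U_of_sq_lin₂ := fun x z w => by
      apply S.injective_subtype
      simp only [hs, hU, hc, hU₂, map_add, QuadraticJordanAlgebra.U_of_sq_lin₂]
    U_of_U := fun x y w => by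
      apply S.injective_subtype
      simp only [hs, hU, hc, hU₂, map_add, QuadraticJordanAlgebra.U_of_U]
    U_of_U_lin := fun x z y w => by
      apply S.injective_subtype
      simp only [hs, hU, hc, hU₂, map_add, QuadraticJordanAlgebra.U_of_U_lin]
    U_of_U_lin₂ := fun x z y w => by
      apply S.injective_subtype
      simp only [hs, hU, hc, hU₂, map_add, QuadraticJordanAlgebra.U_of_U_lin₂] }

instance adjoinAlgebra [QuadraticJordanAlgebra F J] (s : Set J) :
    QuadraticJordanAlgebra F (adjoin F s) :=
  subalgebra F (adjoin F s) (isSubalgebra_adjoin F s)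

end Subalgebra

/-! ### Ideals and quotients -/

section Ideal

set_option linter.unusedSimpArgs false

variable (F : Type*) {J : Type*} [CommRing F] [AddCommGroup J] [Module F J]

/-- An ideal `I` of a quadratic Jordan algebra `J`: a subspace with `U_I Ĵ ⊆ I` and `U_Ĵ I ⊆ I`,
where `Ĵ = F1 + J` is the unital hull; as `U_i 1 = i²` and `U_{a1+x} i = a²i + a(x ∘ i) + U_x i`,
this means the following. -/
structure IsIdeal [QuadraticJordanData F J] (I : Submodule F J) : Prop where
  sq_mem : ∀ i ∈ I, sq F i ∈ I
  circ_mem : ∀ x : J, ∀ i ∈ I, circ F x i ∈ I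
  U_mem_inner : ∀ i ∈ I, ∀ x : J, U F i x ∈ I
  U_mem_outer : ∀ x : J, ∀ i ∈ I, U F x i ∈ I

/-- The ideal generated by a set. -/
def idealSpan [QuadraticJordanData F J] (s : Set J) : Submodule F J :=
  sInf {I : Submodule F J | IsIdeal F I ∧ s ⊆ I}

theorem subset_idealSpan [QuadraticJordanData F J] (s : Set J) : s ⊆ idealSpan F s := by
  intro x hx
  simp only [idealSpan, SetLike.mem_coe, Submodule.mem_sInf]
  exact fun S hS => hS.2 hx

theorem isIdeal_idealSpan [QuadraticJordanData F J] (s : Set J) : IsIdeal F (idealSpan F s) where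
  sq_mem i hi := by
    simp only [idealSpan, Submodule.mem_sInf] at hi ⊢
    exact fun S hS => hS.1.sq_mem i (hi S hS)
  circ_mem x i hi := by
    simp only [idealSpan, Submodule.mem_sInf] at hi ⊢
    exact fun S hS => hS.1.circ_mem x i (hi S hS)
  U_mem_inner i hi x := by
    simp only [idealSpan, Submodule.mem_sInf] at hi ⊢
    exact fun S hS => hS.1.U_mem_inner i (hi S hS) x
  U_mem_outer x i hi := by
    simp only [idealSpan, Submodule.mem_sInf] at hi ⊢
    exact fun S hS => hS.1.U_mem_outer x i (hi S hS)

/-- `{i x y} ∈ I` for `i` in an ideal `I`. -/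
theorem IsIdeal.U₂_mem [QuadraticJordanAlgebra F J] {I : Submodule F J} (hI : IsIdeal F I)
    {i : J} (hi : i ∈ I) (x y : J) : U₂ F i y x ∈ I := by
  have h1 := QuadraticJordanAlgebra.V_self (F := F) (x + i) y
  rw [U₂_add_left, sq_add, circ_add_left, circ_add_left,
    ← QuadraticJordanAlgebra.V_self, ← QuadraticJordanAlgebra.V_self] at h1
  simp only [LinearMap.add_apply, map_add] at h1
  have h2 : U₂ F i y x = circ F (circ F x i) y - U₂ F x y i := by
    rw [eq_sub_iff_add_eq, ← sub_eq_zero]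
    rw [← sub_eq_zero] at h1
    rw [← h1]
    abel
  rw [h2]
  refine I.sub_mem ?_ ?_
  · rw [circ_comm]
    exact hI.circ_mem _ _ (hI.circ_mem _ _ hi)
  · simp only [U₂, LinearMap.sub_apply]
    exact I.sub_mem (I.sub_mem (hI.U_mem_outer _ _ hi) (hI.U_mem_outer _ _ hi))
      (hI.U_mem_outer _ _ hi)

theorem IsIdeal.sq_congr [QuadraticJordanAlgebra F J] {I : Submodule F J} (hI : IsIdeal F I)
    {a b : J} (h : a - b ∈ I) :
    (Submodule.Quotient.mk (sq F a) : J ⧸ I) = Submodule.Quotient.mk (sq F b) := by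
  rw [Submodule.Quotient.eq]
  have h1 : sq F a - sq F b = sq F (a - b) + circ F b (a - b) := by
    have := sq_add (F := F) b (a - b)
    rw [add_sub_cancel] at this
    rw [this]; abel
  rw [h1]
  exact I.add_mem (hI.sq_mem _ h) (hI.circ_mem _ _ h)

theorem IsIdeal.U_congr [QuadraticJordanAlgebra F J] {I : Submodule F J} (hI : IsIdeal F I)
    {a b : J} (h : a - b ∈ I) :
    I.mapQ I (U F a) (hI.U_mem_outer a) = I.mapQ I (U F b) (hI.U_mem_outer b) := by
  refine Submodule.linearMap_qext _ (LinearMap.ext fun w => ?_)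
  simp only [LinearMap.comp_apply, Submodule.mkQ_apply, Submodule.mapQ_apply]
  rw [Submodule.Quotient.eq]
  have h1 : U F a w - U F b w = U F (a - b) w + U₂ F (a - b) b w := by
    have := U_add (F := F) (a - b) b
    rw [sub_add_cancel] at this
    rw [this]
    simp only [LinearMap.add_apply]; abel
  rw [h1]
  exact I.add_mem (hI.U_mem_inner _ h _) (hI.U₂_mem F h _ _)

/-- The products induced on the quotient by an ideal: `x̄² = \overline{x²}` and
`U_x̄ ȳ = \overline{U_x y}`. -/
abbrev quotientData [QuadraticJordanAlgebra F J] (I : Submodule F J) (hI : IsIdeal F I) :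
    QuadraticJordanData F (J ⧸ I) where
  sqMap := QuadraticMap.ofPolar
    (fun q => Quotient.liftOn' q (fun a => (Submodule.Quotient.mk (sq F a) : J ⧸ I))
      (fun _ _ h => hI.sq_congr F ((Submodule.quotientRel_def I).1 h)))
    (fun c q => Submodule.Quotient.induction_on _ q fun a =>
      congrArg (Submodule.Quotient.mk (p := I)) (sq_smul c a))
    (fun q q' r => Submodule.Quotient.induction_on _ q fun a =>
      Submodule.Quotient.induction_on _ q' fun a' => Submodule.Quotient.induction_on _ r fun b =>
        congrArg (Submodule.Quotient.mk (p := I)) (circ_add_left (F := F) a a' b))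
    (fun c q r => Submodule.Quotient.induction_on _ q fun a =>
      Submodule.Quotient.induction_on _ r fun b =>
        congrArg (Submodule.Quotient.mk (p := I)) (circ_smul_left c a b))
  UMap := QuadraticMap.ofPolar
    (fun q => Quotient.liftOn' q (fun a => I.mapQ I (U F a) (hI.U_mem_outer a))
      (fun _ _ h => hI.U_congr F ((Submodule.quotientRel_def I).1 h)))
    (fun c q => Submodule.Quotient.induction_on _ q fun a =>
      Submodule.linearMap_qext _ (LinearMap.ext fun w =>
        congrArg (Submodule.Quotient.mk (p := I)) (LinearMap.congr_fun (U_smul c a) w)))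
    (fun q q' r => Submodule.Quotient.induction_on _ q fun a =>
      Submodule.Quotient.induction_on _ q' fun a' => Submodule.Quotient.induction_on _ r fun b =>
        Submodule.linearMap_qext _ (LinearMap.ext fun w =>
          congrArg (Submodule.Quotient.mk (p := I))
            (LinearMap.congr_fun (U₂_add_left (F := F) a a' b) w)))
    (fun c q r => Submodule.Quotient.induction_on _ q fun a =>
      Submodule.Quotient.induction_on _ r fun b =>
        Submodule.linearMap_qext _ (LinearMap.ext fun w =>
          congrArg (Submodule.Quotient.mk (p := I))
            (LinearMap.congr_fun (U₂_smul_left c a b) w)))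

/-- The quotient of a quadratic Jordan algebra by an ideal is one. -/
abbrev quotient [QuadraticJordanAlgebra F J] (I : Submodule F J) (hI : IsIdeal F I) :
    QuadraticJordanAlgebra F (J ⧸ I) :=
  letI := quotientData F I hI
  have hs : ∀ x : J, sq F (I.mkQ x) = I.mkQ (sq F x) := fun _ => rfl
  have hU : ∀ x y : J, U F (I.mkQ x) (I.mkQ y) = I.mkQ (U F x y) := fun _ _ => rfl
  have hc : ∀ x y : J, circ F (I.mkQ x) (I.mkQ y) = I.mkQ (circ F x y) := fun _ _ => rfl
  have hU₂ : ∀ x z y : J, U₂ F (I.mkQ x) (I.mkQ z) (I.mkQ y) = I.mkQ (U₂ F x z y) :=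
    fun _ _ _ => rfl
  { V_self := fun x y => by
      obtain ⟨x, rfl⟩ := I.mkQ_surjective x
      obtain ⟨y, rfl⟩ := I.mkQ_surjective y
      simp only [hs, hU, hc, hU₂, ← map_add, QuadraticJordanAlgebra.V_self]
    U_V := fun x w => by
      obtain ⟨x, rfl⟩ := I.mkQ_surjective x
      obtain ⟨w, rfl⟩ := I.mkQ_surjective w
      simp only [hs, hU, hc, hU₂, ← map_add, QuadraticJordanAlgebra.U_V]
    U_V_lin := fun x z w => by
      obtain ⟨x, rfl⟩ := I.mkQ_surjective x
      obtain ⟨z, rfl⟩ := I.mkQ_surjective z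
      obtain ⟨w, rfl⟩ := I.mkQ_surjective w
      simp only [hs, hU, hc, hU₂, ← map_add, QuadraticJordanAlgebra.U_V_lin]
    U_sq := fun x => by
      obtain ⟨x, rfl⟩ := I.mkQ_surjective x
      simp only [hs, hU, hc, hU₂, ← map_add, QuadraticJordanAlgebra.U_sq]
    U_sq_lin := fun x z => by
      obtain ⟨x, rfl⟩ := I.mkQ_surjective x
      obtain ⟨z, rfl⟩ := I.mkQ_surjective z
      simp only [hs, hU, hc, hU₂, ← map_add, QuadraticJordanAlgebra.U_sq_lin]
    U_sq_lin₂ := fun x z => by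
      obtain ⟨x, rfl⟩ := I.mkQ_surjective x
      obtain ⟨z, rfl⟩ := I.mkQ_surjective z
      simp only [hs, hU, hc, hU₂, ← map_add, QuadraticJordanAlgebra.U_sq_lin₂]
    sq_U := fun x y => by
      obtain ⟨x, rfl⟩ := I.mkQ_surjective x
      obtain ⟨y, rfl⟩ := I.mkQ_surjective y
      simp only [hs, hU, hc, hU₂, ← map_add, QuadraticJordanAlgebra.sq_U]
    sq_U_lin := fun x z y => by
      obtain ⟨x, rfl⟩ := I.mkQ_surjective x
      obtain ⟨z, rfl⟩ := I.mkQ_surjective z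
      obtain ⟨y, rfl⟩ := I.mkQ_surjective y
      simp only [hs, hU, hc, hU₂, ← map_add, QuadraticJordanAlgebra.sq_U_lin]
    sq_U_lin₂ := fun x z y => by
      obtain ⟨x, rfl⟩ := I.mkQ_surjective x
      obtain ⟨z, rfl⟩ := I.mkQ_surjective z
      obtain ⟨y, rfl⟩ := I.mkQ_surjective y
      simp only [hs, hU, hc, hU₂, ← map_add, QuadraticJordanAlgebra.sq_U_lin₂]
    U_of_sq := fun x w => by
      obtain ⟨x, rfl⟩ := I.mkQ_surjective x
      obtain ⟨w, rfl⟩ := I.mkQ_surjective w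
      simp only [hs, hU, hc, hU₂, ← map_add, QuadraticJordanAlgebra.U_of_sq]
    U_of_sq_lin := fun x z w => by
      obtain ⟨x, rfl⟩ := I.mkQ_surjective x
      obtain ⟨z, rfl⟩ := I.mkQ_surjective z
      obtain ⟨w, rfl⟩ := I.mkQ_surjective w
      simp only [hs, hU, hc, hU₂, ← map_add, QuadraticJordanAlgebra.U_of_sq_lin]
    U_of_sq_lin₂ := fun x z w => by
      obtain ⟨x, rfl⟩ := I.mkQ_surjective x
      obtain ⟨z, rfl⟩ := I.mkQ_surjective z
      obtain ⟨w, rfl⟩ := I.mkQ_surjective w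
      simp only [hs, hU, hc, hU₂, ← map_add, QuadraticJordanAlgebra.U_of_sq_lin₂]
    U_of_U := fun x y w => by
      obtain ⟨x, rfl⟩ := I.mkQ_surjective x
      obtain ⟨y, rfl⟩ := I.mkQ_surjective y
      obtain ⟨w, rfl⟩ := I.mkQ_surjective w
      simp only [hs, hU, hc, hU₂, ← map_add, QuadraticJordanAlgebra.U_of_U]
    U_of_U_lin := fun x z y w => by
      obtain ⟨x, rfl⟩ := I.mkQ_surjective x
      obtain ⟨z, rfl⟩ := I.mkQ_surjective z
      obtain ⟨y, rfl⟩ := I.mkQ_surjective y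
      obtain ⟨w, rfl⟩ := I.mkQ_surjective w
      simp only [hs, hU, hc, hU₂, ← map_add, QuadraticJordanAlgebra.U_of_U_lin]
    U_of_U_lin₂ := fun x z y w => by
      obtain ⟨x, rfl⟩ := I.mkQ_surjective x
      obtain ⟨z, rfl⟩ := I.mkQ_surjective z
      obtain ⟨y, rfl⟩ := I.mkQ_surjective y
      obtain ⟨w, rfl⟩ := I.mkQ_surjective w
      simp only [hs, hU, hc, hU₂, ← map_add, QuadraticJordanAlgebra.U_of_U_lin₂] }

instance idealSpanQuotient [QuadraticJordanAlgebra F J] (s : Set J) :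
    QuadraticJordanAlgebra F (J ⧸ idealSpan F s) :=
  quotient F (idealSpan F s) (isIdeal_idealSpan F s)

end Ideal

/-! ### The free special Jordan algebra -/

section FreeSpecial

variable (F : Type*) [CommRing F] (X : Type*)

/-- The free special Jordan algebra `SJ[X]`: the Jordan subalgebra generated by `X` of `F⟨X⟩⁺`,
where `F⟨X⟩` is the free associative algebra. -/
abbrev SJ : Type _ :=
  adjoin F (Set.range fun i : X => SymAlg.sym (FreeAlgebra.ι F i))

variable {X}

/-- The free generators of `SJ[X]`. -/
def SJ.gen (i : X) : SJ F X :=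
  ⟨SymAlg.sym (FreeAlgebra.ι F i), subset_adjoin F _ (Set.mem_range_self i)⟩

end FreeSpecial

end QuadraticJordan

/-!
The quotient `J` is not special: if `xy = -yx` held in an associative envelope, then `xyzyx` and
`yxzxy` would be equal, but `t = xyzyx - yxzxy` does not lie in the *Jordan* ideal generated by
`p = x ∘ y`, although it lies in the associative one. Evaluating both operators at `z`, this is
what has to be shown.

Everything is multihomogeneous, so only noncommutative polynomials of degree at most `(2, 2, 1)`
in `x, y, z` matter. In degree `(2, 2, 1)` the elements of the ideal satisfy linear relations
between the coefficients of their words, and one of them, with integral coefficients, takes the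
value `1` on `t`; so it separates `t` from the ideal in every characteristic. It is the field `top`
of `IsAnnihilated`. To see that it vanishes on the ideal, consider the largest ideal on which it
vanishes. It is again given by linear relations: those obtained from `top` by pulling back along
the multiplications `i ↦ a ∘ i`, `i ↦ U_{a, b} i` and `i ↦ U_a i`. Carried out over `ℚ` and cleared
of denominators, this leads to the other fields of `IsAnnihilated`. That these relations do cut out
an ideal, in every characteristic, is a direct computation with coefficients
(`IsAnnihilated.mul_self`, `IsAnnihilated.mul_add_mul`, `IsAnnihilated.mul_mul_inner`,
`IsAnnihilated.mul_mul_outer`). It uses only that elements of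
`SJ[x, y, z]` are invariant under the reversal of words and have no constant term
(`wordCoeff_toFree_reverse`, `wordCoeff_toFree_nil`). As `p` satisfies all the relations, the ideal
generated by `p` is contained in the ideal that they define, and `t` is not.
-/

section Proof

open QuadraticJordan SymAlg

/-! ### Coefficients of words -/

section WordCoeff

variable {F : Type*} [CommRing F] {X : Type*}

/-- The coefficient of the word `w` in a noncommutative polynomial. -/
noncomputable def wordCoeff (a : FreeAlgebra F X) (w : List X) : F :=
  (FreeAlgebra.equivMonoidAlgebraFreeMonoid a).coeff (FreeMonoid.ofList w)

theorem wordCoeff_add (a b : FreeAlgebra F X) (w : List X) :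
    wordCoeff (a + b) w = wordCoeff a w + wordCoeff b w := by
  simp [wordCoeff]

theorem wordCoeff_zero (w : List X) : wordCoeff (0 : FreeAlgebra F X) w = 0 := by
  simp [wordCoeff]

theorem wordCoeff_sub (a b : FreeAlgebra F X) (w : List X) :
    wordCoeff (a - b) w = wordCoeff a w - wordCoeff b w := by
  simp [wordCoeff]

theorem wordCoeff_smul (r : F) (a : FreeAlgebra F X) (w : List X) :
    wordCoeff (r • a) w = r * wordCoeff a w := by
  simp [wordCoeff]

theorem wordCoeff_prod_map_ι [DecidableEq X] (v w : List X) :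
    wordCoeff (v.map (FreeAlgebra.ι F)).prod w = if w = v then 1 else 0 := by
  classical
  have hv : FreeAlgebra.equivMonoidAlgebraFreeMonoid (v.map (FreeAlgebra.ι F)).prod =
      MonoidAlgebra.single (FreeMonoid.ofList v) 1 := by
    induction v with
    | nil => simp [MonoidAlgebra.one_def]
    | cons i v hv =>
      rw [List.map_cons, List.prod_cons, map_mul, hv]
      simp [FreeAlgebra.equivMonoidAlgebraFreeMonoid]
  rw [wordCoeff, hv, MonoidAlgebra.coeff_single, Finsupp.single_apply]
  exact if_congr eq_comm rfl rfl

theorem wordCoeff_ι [DecidableEq X] (i : X) (w : List X) :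
    wordCoeff (FreeAlgebra.ι F i) w = if w = [i] then 1 else 0 := by
  simpa using wordCoeff_prod_map_ι (F := F) [i] w

theorem wordCoeff_algebraMap_cons (r : F) (i : X) (w : List X) :
    wordCoeff (algebraMap F (FreeAlgebra F X) r) (i :: w) = 0 := by
  classical
  simp only [wordCoeff, AlgEquiv.commutes, MonoidAlgebra.coe_algebraMap, Function.comp_apply,
    MonoidAlgebra.coeff_single, Finsupp.single_apply]
  exact if_neg fun h => List.cons_ne_nil i w h.symm

/-- The coefficient of `w` in a product is a sum over the factorizations of `w`. -/
theorem wordCoeff_mul (a b : FreeAlgebra F X) (w : List X) :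
    wordCoeff (a * b) w =
      ∑ n ∈ Finset.range (w.length + 1), wordCoeff a (w.take n) * wordCoeff b (w.drop n) := by
  classical
  rw [wordCoeff, map_mul, MonoidAlgebra.coeff_mul_antidiag _ _ _
    ((Finset.range (w.length + 1)).image fun n =>
      (FreeMonoid.ofList (w.take n), FreeMonoid.ofList (w.drop n)))]
  · rw [Finset.sum_image]
    · rfl
    · intro m hm n hn h
      simp only [Finset.coe_range, Set.mem_Iio] at hm hn
      have := congrArg (fun p => p.1.toList.length) h
      simp at this
      omega
  · rintro ⟨u, v⟩
    simp only [Finset.mem_image, Finset.mem_range, Prod.mk.injEq]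
    constructor
    · rintro ⟨n, -, rfl, rfl⟩
      rw [← FreeMonoid.ofList_append, List.take_append_drop]
    · intro h
      have h' : w = u.toList ++ v.toList := by
        rw [← FreeMonoid.toList_mul, h, FreeMonoid.toList_ofList]
      exact ⟨u.toList.length, by simp [h'], by simp [h'], by simp [h']⟩

/-- The reversal of `F⟨X⟩` reverses the words. -/
theorem wordCoeff_star (a : FreeAlgebra F X) (w : List X) :
    wordCoeff (star a) w = wordCoeff a w.reverse := by
  classical
  induction a using FreeAlgebra.induction generalizing w with
  | grade0 r =>
    rw [FreeAlgebra.star_algebraMap]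
    cases w with
    | nil => rfl
    | cons i w =>
      obtain ⟨j, v, hv⟩ := List.exists_cons_of_ne_nil
        (List.reverse_ne_nil_iff.2 (List.cons_ne_nil i w))
      rw [hv, wordCoeff_algebraMap_cons, wordCoeff_algebraMap_cons]
  | grade1 i =>
    rw [FreeAlgebra.star_ι, wordCoeff_ι, wordCoeff_ι]
    refine if_congr ?_ rfl rfl
    rw [List.reverse_eq_iff, List.reverse_singleton]
  | add a b ha hb => rw [star_add, wordCoeff_add, wordCoeff_add, ha, hb]
  | mul a b ha hb =>
    rw [star_mul, wordCoeff_mul, wordCoeff_mul, ← Finset.sum_range_reflect, List.length_reverse]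
    refine Finset.sum_congr rfl fun n hn => ?_
    have hn : n ≤ w.length := by simpa [Nat.lt_succ_iff] using hn
    rw [ha, hb, _root_.mul_comm, List.take_reverse, List.drop_reverse]
    rfl

end WordCoeff

/-! ### Special Jordan polynomials are reversible -/

section Reversible

variable {F : Type*} [CommRing F] {X : Type*}

/-- The elements of `SJ[X]` are invariant under reversal and have no constant term. -/
theorem star_unsym_and_wordCoeff_nil_of_mem_adjoin {a : (FreeAlgebra F X)ˢʸᵐ}
    (ha : a ∈ adjoin F (Set.range fun i : X => sym (FreeAlgebra.ι F i))) :
    star (unsym a) = unsym a ∧ wordCoeff (unsym a) [] = 0 := by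
  classical
  let S : Submodule F (FreeAlgebra F X)ˢʸᵐ :=
    { carrier := {a | star (unsym a) = unsym a ∧ wordCoeff (unsym a) [] = 0}
      zero_mem' := by simp [wordCoeff_zero]
      add_mem' := by
        rintro a b ⟨ha, ha'⟩ ⟨hb, hb'⟩
        exact ⟨by rw [unsym_add, star_add, ha, hb],
          by rw [unsym_add, wordCoeff_add, ha', hb', add_zero]⟩
      smul_mem' := by
        rintro r a ⟨ha, ha'⟩
        refine ⟨?_, by rw [unsym_smul, wordCoeff_smul, ha', mul_zero]⟩
        rw [unsym_smul, Algebra.smul_def, star_mul, ha, FreeAlgebra.star_algebraMap,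
          Algebra.commutes] }
  have hS : IsSubalgebra F S :=
    { sq_mem := by
        rintro a ⟨ha, ha'⟩
        exact ⟨by rw [unsym_sq, star_mul, ha], by simp [unsym_sq, wordCoeff_mul, ha']⟩
      U_mem := by
        rintro a ⟨ha, ha'⟩ b ⟨hb, -⟩
        exact ⟨by rw [unsym_U, star_mul, star_mul, ha, hb, mul_assoc],
          by simp [unsym_U, wordCoeff_mul, ha']⟩ }
  have hX : (Set.range fun i : X => sym (FreeAlgebra.ι F i)) ⊆ S := by
    rintro _ ⟨i, rfl⟩
    exact ⟨by rw [unsym_sym, FreeAlgebra.star_ι], by simp [wordCoeff_ι]⟩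
  rw [adjoin, Submodule.mem_sInf] at ha
  exact ha S ⟨hS, hX⟩

/-- The noncommutative polynomial underlying an element of `SJ[X]`. -/
def QuadraticJordan.SJ.toFree (a : SJ F X) : FreeAlgebra F X := unsym (a : (FreeAlgebra F X)ˢʸᵐ)

theorem toFree_gen (i : X) : (SJ.gen F i).toFree = FreeAlgebra.ι F i := rfl

theorem toFree_zero : (0 : SJ F X).toFree = 0 := rfl

theorem toFree_add (a b : SJ F X) : (a + b).toFree = a.toFree + b.toFree := rfl

theorem toFree_sub (a b : SJ F X) : (a - b).toFree = a.toFree - b.toFree := rfl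

theorem toFree_smul (r : F) (a : SJ F X) : (r • a).toFree = r • a.toFree := rfl

theorem toFree_sq (a : SJ F X) : (sq F a).toFree = a.toFree * a.toFree := rfl

theorem toFree_U (a b : SJ F X) : (U F a b).toFree = a.toFree * b.toFree * a.toFree := rfl

theorem toFree_circ (a b : SJ F X) :
    (circ F a b).toFree = a.toFree * b.toFree + b.toFree * a.toFree :=
  unsym_circ F _ _

theorem wordCoeff_toFree_reverse (a : SJ F X) (w : List X) :
    wordCoeff a.toFree w.reverse = wordCoeff a.toFree w := by
  rw [← wordCoeff_star, SJ.toFree, (star_unsym_and_wordCoeff_nil_of_mem_adjoin a.2).1]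

theorem wordCoeff_toFree_nil (a : SJ F X) : wordCoeff a.toFree [] = 0 :=
  (star_unsym_and_wordCoeff_nil_of_mem_adjoin a.2).2

end Reversible

/-! ### An ideal that separates the two operators -/

section Ideal

/-- The linear relations on the coefficients `c w` of a reversible polynomial that define an ideal
of `SJ[x, y, z]` containing `x ∘ y` but not `xyzyx - yxzxy`; the letters `0, 1, 2` stand for
`x, y, z`. The relation `top` in degree `(2, 2, 1)` is the one that separates; the others, in
lower degrees, make the set of solutions closed under multiplication by `SJ[x, y, z]`. -/
structure IsAnnihilated {F : Type*} [CommRing F] (c : List (Fin 3) → F) : Prop where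
  x : c [0] = 0
  y : c [1] = 0
  z : c [2] = 0
  xx : c [0, 0] = 0
  yy : c [1, 1] = 0
  yz : c [1, 2] = 0
  yxy : c [1, 0, 1] = 2 * c [0, 1, 1]
  xyx : c [0, 1, 0] = 2 * c [0, 0, 1]
  xzx : c [0, 2, 0] = 2 * c [0, 0, 2]
  yxz : c [1, 0, 2] = c [0, 1, 2] + c [0, 2, 1]
  yxyz : c [1, 0, 1, 2] = c [0, 1, 1, 2] - c [0, 2, 1, 1] + c [1, 1, 0, 2]
  top : 2 * c [0, 0, 1, 1, 2] - c [0, 1, 0, 1, 2] - c [0, 1, 0, 2, 1] + c [0, 1, 2, 0, 1]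
    + 2 * c [0, 2, 0, 1, 1] - 2 * c [1, 1, 0, 0, 2] + c [1, 0, 1, 0, 2] + 2 * c [1, 0, 0, 2, 1]
    - c [1, 0, 2, 0, 1] - c [0, 2, 1, 0, 1] - 2 * c [0, 0, 2, 1, 1] = 0

/-- The values of a reversal-invariant function on words of length at most `4` and degree at most
`(2, 2, 1)`, in terms of those on the lexicographically smaller of a word and its reversal. -/
theorem eval_reverse {F : Type*} {c : List (Fin 3) → F} (h : ∀ w, c w.reverse = c w) :
    (c [1, 0] = c [0, 1] ∧ c [2, 0] = c [0, 2] ∧ c [2, 1] = c [1, 2]) ∧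
    (c [1, 0, 0] = c [0, 0, 1] ∧ c [2, 0, 0] = c [0, 0, 2] ∧ c [1, 1, 0] = c [0, 1, 1] ∧
      c [2, 1, 1] = c [1, 1, 2] ∧ c [2, 1, 0] = c [0, 1, 2] ∧ c [1, 2, 0] = c [0, 2, 1] ∧
      c [2, 0, 1] = c [1, 0, 2]) ∧
    (c [2, 1, 1, 0] = c [0, 1, 1, 2] ∧ c [1, 2, 1, 0] = c [0, 1, 2, 1] ∧
      c [1, 1, 2, 0] = c [0, 2, 1, 1] ∧ c [2, 1, 0, 1] = c [1, 0, 1, 2] ∧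
      c [1, 2, 0, 1] = c [1, 0, 2, 1] ∧ c [2, 0, 1, 1] = c [1, 1, 0, 2]) ∧
    (c [2, 1, 0, 0] = c [0, 0, 1, 2] ∧ c [1, 2, 0, 0] = c [0, 0, 2, 1] ∧
      c [2, 0, 1, 0] = c [0, 1, 0, 2] ∧ c [0, 2, 1, 0] = c [0, 1, 2, 0] ∧
      c [1, 0, 2, 0] = c [0, 2, 0, 1] ∧ c [2, 0, 0, 1] = c [1, 0, 0, 2]) ∧
    (c [1, 1, 0, 0] = c [0, 0, 1, 1] ∧ c [1, 0, 1, 0] = c [0, 1, 0, 1]) :=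
  ⟨⟨h [0, 1], h [0, 2], h [1, 2]⟩,
    ⟨h [0, 0, 1], h [0, 0, 2], h [0, 1, 1], h [1, 1, 2], h [0, 1, 2], h [0, 2, 1], h [1, 0, 2]⟩,
    ⟨h [0, 1, 1, 2], h [0, 1, 2, 1], h [0, 2, 1, 1], h [1, 0, 1, 2], h [1, 0, 2, 1],
      h [1, 1, 0, 2]⟩,
    ⟨h [0, 0, 1, 2], h [0, 0, 2, 1], h [0, 1, 0, 2], h [0, 1, 2, 0], h [0, 2, 0, 1],
      h [1, 0, 0, 2]⟩,
    ⟨h [0, 0, 1, 1], h [0, 1, 0, 1]⟩⟩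

section Closure

variable {F : Type*} [CommRing F] {a b : FreeAlgebra F (Fin 3)}

theorem IsAnnihilated.mul_self (h : IsAnnihilated (wordCoeff b))
    (hb : ∀ w, wordCoeff b w.reverse = wordCoeff b w) (hb₀ : wordCoeff b [] = 0) :
    IsAnnihilated (wordCoeff (b * b)) := by
  -- The relation `top` of `b` is not needed: since constant terms vanish, no coefficient of `b` in
  -- degree `(2, 2, 1)` occurs.
  obtain ⟨x, y, z, xx, yy, yz, yxy, xyx, xzx, yxz, yxyz, -⟩ := h
  have rb := eval_reverse hb
  constructor <;>
    simp only [wordCoeff_mul, Finset.sum_range_succ, Finset.sum_range_zero,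
      List.length_cons, List.length_nil, List.take_succ_cons, List.take_zero, List.drop_succ_cons,
      List.drop_zero, zero_add, Nat.reduceAdd, hb₀, zero_mul, mul_zero, add_zero, rb,
      x, y, z, xx, yy, yz, yxy, xyx, xzx, yxz, yxyz] <;>
    ring

theorem IsAnnihilated.mul_add_mul (h : IsAnnihilated (wordCoeff b))
    (ha : ∀ w, wordCoeff a w.reverse = wordCoeff a w) (ha₀ : wordCoeff a [] = 0)
    (hb : ∀ w, wordCoeff b w.reverse = wordCoeff b w) (hb₀ : wordCoeff b [] = 0) :
    IsAnnihilated (wordCoeff (a * b + b * a)) := by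
  obtain ⟨x, y, z, xx, yy, yz, yxy, xyx, xzx, yxz, yxyz, -⟩ := h
  have ra := eval_reverse ha
  have rb := eval_reverse hb
  constructor <;>
    simp only [wordCoeff_add, wordCoeff_mul, Finset.sum_range_succ, Finset.sum_range_zero,
      List.length_cons, List.length_nil, List.take_succ_cons, List.take_zero, List.drop_succ_cons,
      List.drop_zero, zero_add, Nat.reduceAdd, ha₀, hb₀, zero_mul, mul_zero, add_zero, ra, rb,
      x, y, z, xx, yy, yz, yxy, xyx, xzx, yxz, yxyz] <;>
    ring

theorem IsAnnihilated.mul_mul_inner (h : IsAnnihilated (wordCoeff b))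
    (ha : ∀ w, wordCoeff a w.reverse = wordCoeff a w) (ha₀ : wordCoeff a [] = 0)
    (hb : ∀ w, wordCoeff b w.reverse = wordCoeff b w) (hb₀ : wordCoeff b [] = 0) :
    IsAnnihilated (wordCoeff (b * a * b)) := by
  obtain ⟨x, y, z, xx, yy, yz, yxy, xyx, xzx, yxz, yxyz, -⟩ := h
  have ra := eval_reverse ha
  have rb := eval_reverse hb
  constructor <;>
    simp only [wordCoeff_mul, Finset.sum_range_succ, Finset.sum_range_zero,
      List.length_cons, List.length_nil, List.take_succ_cons, List.take_zero, List.drop_succ_cons,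
      List.drop_zero, zero_add, Nat.reduceAdd, ha₀, hb₀, zero_mul, mul_zero, add_zero, ra, rb,
      x, y, z, xx, yy, yz, yxy, xyx, xzx, yxz, yxyz] <;>
    ring

theorem IsAnnihilated.mul_mul_outer (h : IsAnnihilated (wordCoeff b))
    (ha : ∀ w, wordCoeff a w.reverse = wordCoeff a w) (ha₀ : wordCoeff a [] = 0)
    (hb : ∀ w, wordCoeff b w.reverse = wordCoeff b w) (hb₀ : wordCoeff b [] = 0) :
    IsAnnihilated (wordCoeff (a * b * a)) := by
  obtain ⟨x, y, z, xx, yy, yz, yxy, xyx, xzx, yxz, yxyz, -⟩ := h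
  have ra := eval_reverse ha
  have rb := eval_reverse hb
  constructor <;>
    simp only [wordCoeff_mul, Finset.sum_range_succ, Finset.sum_range_zero,
      List.length_cons, List.length_nil, List.take_succ_cons, List.take_zero, List.drop_succ_cons,
      List.drop_zero, zero_add, Nat.reduceAdd, ha₀, hb₀, zero_mul, mul_zero, add_zero, ra, rb,
      x, y, z, xx, yy, yz, yxy, xyx, xzx, yxz, yxyz] <;>
    ring

end Closure

/-- The special Jordan polynomials in `x, y, z` that satisfy the relations `IsAnnihilated`. -/
def annihilatedIdeal (F : Type*) [CommRing F] : Submodule F (SJ F (Fin 3)) where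
  carrier := {a | IsAnnihilated (wordCoeff a.toFree)}
  zero_mem' := by
    constructor <;> simp [toFree_zero, wordCoeff_zero]
  add_mem' := by
    rintro a b ha hb
    constructor <;> simp only [toFree_add, wordCoeff_add]
    · linear_combination ha.x + hb.x
    · linear_combination ha.y + hb.y
    · linear_combination ha.z + hb.z
    · linear_combination ha.xx + hb.xx
    · linear_combination ha.yy + hb.yy
    · linear_combination ha.yz + hb.yz
    · linear_combination ha.yxy + hb.yxy
    · linear_combination ha.xyx + hb.xyx
    · linear_combination ha.xzx + hb.xzx
    · linear_combination ha.yxz + hb.yxz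
    · linear_combination ha.yxyz + hb.yxyz
    · linear_combination ha.top + hb.top
  smul_mem' := by
    rintro r a ha
    constructor <;> simp only [toFree_smul, wordCoeff_smul]
    · linear_combination r * ha.x
    · linear_combination r * ha.y
    · linear_combination r * ha.z
    · linear_combination r * ha.xx
    · linear_combination r * ha.yy
    · linear_combination r * ha.yz
    · linear_combination r * ha.yxy
    · linear_combination r * ha.xyx
    · linear_combination r * ha.xzx
    · linear_combination r * ha.yxz
    · linear_combination r * ha.yxyz
    · linear_combination r * ha.top

theorem mem_annihilatedIdeal {F : Type*} [CommRing F] {a : SJ F (Fin 3)} :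
    a ∈ annihilatedIdeal F ↔ IsAnnihilated (wordCoeff a.toFree) :=
  Iff.rfl

theorem isIdeal_annihilatedIdeal (F : Type*) [CommRing F] : IsIdeal F (annihilatedIdeal F) where
  sq_mem b hb := by
    rw [mem_annihilatedIdeal, toFree_sq]
    exact hb.mul_self (wordCoeff_toFree_reverse b) (wordCoeff_toFree_nil b)
  circ_mem a b hb := by
    rw [mem_annihilatedIdeal, toFree_circ]
    exact hb.mul_add_mul (wordCoeff_toFree_reverse a) (wordCoeff_toFree_nil a)
      (wordCoeff_toFree_reverse b) (wordCoeff_toFree_nil b)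
  U_mem_inner b hb a := by
    rw [mem_annihilatedIdeal, toFree_U]
    exact hb.mul_mul_inner (wordCoeff_toFree_reverse a) (wordCoeff_toFree_nil a)
      (wordCoeff_toFree_reverse b) (wordCoeff_toFree_nil b)
  U_mem_outer a b hb := by
    rw [mem_annihilatedIdeal, toFree_U]
    exact hb.mul_mul_outer (wordCoeff_toFree_reverse a) (wordCoeff_toFree_nil a)
      (wordCoeff_toFree_reverse b) (wordCoeff_toFree_nil b)

/-- None of the relations involves the words `xy` and `yx`, so they all hold for `xy + yx`. -/
theorem circ_mem_annihilatedIdeal (F : Type*) [CommRing F] :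
    circ F (SJ.gen F 0) (SJ.gen F 1) ∈ annihilatedIdeal F := by
  rw [mem_annihilatedIdeal, toFree_circ, toFree_gen, toFree_gen]
  constructor <;> simp [wordCoeff_add, wordCoeff_mul, Finset.sum_range_succ, wordCoeff_ι]

/-- The word `xyzyx` does not occur in the relation `top`, and `yxzxy` occurs with coefficient
`-1`; so `top` takes the value `1` on `xyzyx - yxzxy`. -/
theorem U_U_sub_U_U_notMem_annihilatedIdeal (F : Type*) [CommRing F] [Nontrivial F] :
    U F (SJ.gen F 0) (U F (SJ.gen F 1) (SJ.gen F 2)) -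
      U F (SJ.gen F 1) (U F (SJ.gen F 0) (SJ.gen F (2 : Fin 3))) ∉ annihilatedIdeal F := by
  intro h
  have ht : (U F (SJ.gen F 0) (U F (SJ.gen F 1) (SJ.gen F 2)) -
      U F (SJ.gen F 1) (U F (SJ.gen F 0) (SJ.gen F (2 : Fin 3)))).toFree =
      ([0, 1, 2, 1, 0].map (FreeAlgebra.ι F)).prod -
        ([1, 0, 2, 0, 1].map (FreeAlgebra.ι F)).prod := by
    simp [toFree_sub, toFree_U, toFree_gen, mul_assoc]
  rw [mem_annihilatedIdeal, ht] at h
  have := h.top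
  simp only [wordCoeff_sub, wordCoeff_prod_map_ι] at this
  simp at this

end Ideal

end Proof

open QuadraticJordan in
theorem theorem1 (F : Type*) [Field F] :
    let x : SJ F (Fin 3) := SJ.gen F 0
    let y : SJ F (Fin 3) := SJ.gen F 1
    let I : Submodule F (SJ F (Fin 3)) := idealSpan F {circ F x y}
    let x' : SJ F (Fin 3) ⧸ I := Submodule.Quotient.mk x
    let y' : SJ F (Fin 3) ⧸ I := Submodule.Quotient.mk y
    circ F x' y' = 0 ∧ U F x' ∘ₗ U F y' ≠ U F y' ∘ₗ U F x' := by
  intro x y I x' y'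
  refine ⟨(Submodule.Quotient.mk_eq_zero I).2 (subset_idealSpan F _ rfl), fun hU => ?_⟩
  have hle : I ≤ annihilatedIdeal F :=
    sInf_le ⟨isIdeal_annihilatedIdeal F,
      Set.singleton_subset_iff.2 (circ_mem_annihilatedIdeal F)⟩
  have hz : (Submodule.Quotient.mk (U F x (U F y (SJ.gen F 2))) : SJ F (Fin 3) ⧸ I) =
      Submodule.Quotient.mk (U F y (U F x (SJ.gen F 2))) :=
    LinearMap.congr_fun hU (Submodule.Quotient.mk (SJ.gen F 2))
  exact U_U_sub_U_U_notMem_annihilatedIdeal F (hle ((Submodule.Quotient.eq I).1 hz))
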